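/- For $i\in[n]$ let $D_i$ be the $2^n\times 2^n$ matrix, with rows and columns indexed by $\{0,1\}^n$, with $D_i(x,y)=1$ if $x_i\neq y_i$ and $D_i(x,y)=0$ otherwise. Let $\circ$ between matrices denote the entrywise product and $\|\cdot\|$ the spectral norm. For a Boolean function $g:\{0,1\}^n\to\{0,1\}$, the (negative-weight) adversary bound is $$\mathrm{ADV}^\pm(g)=\max_{\Gamma}\ \|\Gamma\|\quad\text{subject to}\quad \|\Gamma\circ D_i\|\le 1\ \text{ for all } i\in[n],\qquad \Gamma(x,y)=0\ \text{ whenever } g(x)=g(y),$$ over real symmetric $2^n\times 2^n$ matrices $\Gamma$. For a relation $f\subseteq\{0,1\}^n\times[K]$ such that for every $x\in\{0,1\}^n$ there is an $a\in[K]$ with $(x,a)\in f$, the relational adversary bound is $$\mathrm{ADV}^\pm_{rel}(f)=\min_{\{u_{x,i}\},\{v_{x,i}\},\{\sigma_{x,a}\}}\ \max\Big\{\max_{x}\sum_{i\in[n]}\|u_{x,i}\|^2,\ \max_{x}\sum_{i\in[n]}\|v_{x,i}\|^2\Big\}$$ over families of real vectors of arbitrary finite dimension, indexed by $x\in\{0,1\}^n$,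 $i\in[n]$ and $a\in[K]$, subject to $$\sum_{i:\,x_i\ne y_i}\langle u_{x,i},v_{y,i}\rangle=1-\sum_{a\in[K]}\langle\sigma_{x,a},\sigma_{y,a}\rangle\quad\text{for all } x,y\in\{0,1\}^n,\qquad \|\sigma_{x,a}\|^2=0\quad\text{whenever }(x,a)\notin f.$$ Theorem. Let $f\subseteq\{0,1\}^N\times[K]$ be a relation such that for every $z\in\{0,1\}^N$ there is an $a\in[K]$ with $(z,a)\in f$, and let $g:\{0,1\}^m\to\{0,1\}$ be a Boolean function. Let $f\circ g^N\subseteq\{0,1\}^{Nm}\times[K]$ be the relation consisting of all $(x,a)$, $x=(x_1,\dots,x_N)$ with blocks $x_p\in\{0,1\}^m$, such that $\big((g(x_1),\dots,g(x_N)),a\big)\in f$. Then $$\mathrm{ADV}^\pm_{rel}(f\circ g^N)=\mathrm{ADV}^\pm_{rel}(f)\cdot\mathrm{ADV}^\pm(g).$$ -/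

import Mathlib

/-! # The functional and the relational (negative-weight) adversary bounds -/

/-- The Boolean cube `{0,1}^n`. -/
abbrev Cube (n : ℕ) : Type := Fin n → Bool

/-- The `2^n`-by-`2^n` matrix `D_i`, with `D_i(x,y) = 1` iff `x_i ≠ y_i`, and `0` otherwise. -/
def diffMatrix {n : ℕ} (i : Fin n) : Matrix (Cube n) (Cube n) ℝ :=
  Matrix.of fun x y => if x i ≠ y i then 1 else 0

section FunctionalAdversary

-- In this section the norm of a matrix is the spectral norm (`ℓ²`-operator norm).
open scoped Matrix Matrix.Norms.L2Operator

/-- `Γ` is a functional adversary matrix for `g` (it is symmetric and vanishes at `(x, y)`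
whenever `g x = g y`). -/
def IsAdversaryMatrix {n : ℕ} (g : Cube n → Bool) (Γ : Matrix (Cube n) (Cube n) ℝ) : Prop :=
  Γ.IsSymm ∧ ∀ x y, g x = g y → Γ x y = 0

/-- The objective values `‖Γ‖` of the feasible points `Γ` of the maximization problem that
defines `ADV^±(g)`. -/
def advValues {n : ℕ} (g : Cube n → Bool) : Set ℝ :=
  {c | ∃ Γ : Matrix (Cube n) (Cube n) ℝ,
    IsAdversaryMatrix g Γ ∧ (∀ i, ‖Γ ⊙ diffMatrix i‖ ≤ 1) ∧ c = ‖Γ‖}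

/-- The functional adversary bound `ADV^±(g)`. -/
noncomputable def adv {n : ℕ} (g : Cube n → Bool) : ℝ :=
  sSup (advValues g)

/-- The supremum defining `adv` is over a nonempty set. -/
theorem advValues_nonempty {n : ℕ} (g : Cube n → Bool) : (advValues g).Nonempty :=
  ⟨‖(0 : Matrix (Cube n) (Cube n) ℝ)‖, 0, ⟨Matrix.isSymm_zero, fun _ _ _ => rfl⟩,
    fun i => by simp, rfl⟩

/-- The supremum defining `adv` is over a set that is bounded above. -/
theorem advValues_bddAbove {n : ℕ} (g : Cube n → Bool) : BddAbove (advValues g) := by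
  have hsum : ∀ Γ : Matrix (Cube n) (Cube n) ℝ,
      Γ = ∑ x, ∑ y, Γ x y • Matrix.single x y (1 : ℝ) := by
    intro Γ
    conv_lhs => rw [Matrix.matrix_eq_sum_single Γ]
    simp [Matrix.smul_single]
  have hentry : ∀ (A : Matrix (Cube n) (Cube n) ℝ) (x y), |A x y| ≤ ‖A‖ := by
    intro A x y
    have h := Matrix.l2_opNorm_mulVec A (EuclideanSpace.single y (1 : ℝ))
    have h2 := (PiLp.norm_apply_le
      ((EuclideanSpace.equiv (Cube n) ℝ).symm
        (A.mulVec (EuclideanSpace.single y (1 : ℝ)))) x).trans h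
    simpa using h2
  refine ⟨∑ x : Cube n, ∑ y : Cube n, ‖Matrix.single x y (1 : ℝ)‖, ?_⟩
  rintro c ⟨Γ, ⟨-, h0⟩, h1, rfl⟩
  conv_lhs => rw [hsum Γ]
  refine (norm_sum_le _ _).trans (Finset.sum_le_sum fun x _ => ?_)
  refine (norm_sum_le _ _).trans (Finset.sum_le_sum fun y _ => ?_)
  rw [norm_smul]
  refine mul_le_of_le_one_left (norm_nonneg _) ?_
  by_cases hxy : g x = g y
  · simp [h0 x y hxy]
  · have hne : x ≠ y := fun h => hxy (by rw [h])
    obtain ⟨i, hi⟩ := Function.ne_iff.mp hne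
    have h := (hentry _ x y).trans (h1 i)
    simpa [diffMatrix, hi] using h

end FunctionalAdversary

section RelationalAdversary

/-- A relation `f ⊆ {0,1}^n × [K]` is total if every `x` is related to at least one `a`. -/
def IsTotalRel {n K : ℕ} (f : Set (Cube n × Fin K)) : Prop :=
  ∀ x, ∃ a, (x, a) ∈ f

/-- The families of real vectors `u_{x,i}`, `v_{x,i}` (in `ℝ^d`) and `σ_{x,a}` (in `ℝ^e`) satisfy
the constraints of the minimization problem that defines `ADV_rel^±(f)`. -/
def IsRelFeasible {n K : ℕ} (f : Set (Cube n × Fin K)) {d e : ℕ}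
    (u v : Cube n → Fin n → EuclideanSpace ℝ (Fin d))
    (σ : Cube n → Fin K → EuclideanSpace ℝ (Fin e)) : Prop :=
  (∀ x y, ∑ i with x i ≠ y i, inner ℝ (u x i) (v y i) = 1 - ∑ a, inner ℝ (σ x a) (σ y a)) ∧
  ∀ x a, (x, a) ∉ f → ‖σ x a‖ ^ 2 = 0

/-- The objective function
`max {max_x ∑_i ‖u_{x,i}‖², max_x ∑_i ‖v_{x,i}‖²}`. -/
noncomputable def relCost {n d : ℕ} (u v : Cube n → Fin n → EuclideanSpace ℝ (Fin d)) : ℝ :=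
  max (Finset.univ.sup' Finset.univ_nonempty fun x => ∑ i, ‖u x i‖ ^ 2)
    (Finset.univ.sup' Finset.univ_nonempty fun x => ∑ i, ‖v x i‖ ^ 2)

/-- The objective values of the feasible points, in all finite dimensions, of the minimization
problem that defines `ADV_rel^±(f)`. -/
def advRelValues {n K : ℕ} (f : Set (Cube n × Fin K)) : Set ℝ :=
  {c | ∃ (d e : ℕ) (u v : Cube n → Fin n → EuclideanSpace ℝ (Fin d))
    (σ : Cube n → Fin K → EuclideanSpace ℝ (Fin e)), IsRelFeasible f u v σ ∧ c = relCost u v}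

/-- The relational adversary bound `ADV_rel^±(f)`. -/
noncomputable def advRel {n K : ℕ} (f : Set (Cube n × Fin K)) : ℝ :=
  sInf (advRelValues f)

/-- The infimum defining `advRel` is over a set that is bounded below. -/
theorem advRelValues_bddBelow {n K : ℕ} (f : Set (Cube n × Fin K)) :
    BddBelow (advRelValues f) := by
  refine ⟨0, ?_⟩
  rintro c ⟨d, e, u, v, σ, -, rfl⟩
  refine le_max_of_le_left (Finset.le_sup'_of_le _ (Finset.mem_univ fun _ => false) ?_)
  positivity

/-- For a total relation, the infimum defining `advRel` is over a nonempty set. -/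
theorem advRelValues_nonempty {n K : ℕ} (f : Set (Cube n × Fin K)) (hf : IsTotalRel f) :
    (advRelValues f).Nonempty := by
  classical
  choose s hs using hf
  let E : Cube n ≃ Fin (Fintype.card (Cube n)) := Fintype.equivFin _
  let u : Cube n → Fin n → EuclideanSpace ℝ (Fin (Fintype.card (Cube n))) :=
    fun x _ => EuclideanSpace.single (E x) 1
  let v : Cube n → Fin n → EuclideanSpace ℝ (Fin (Fintype.card (Cube n))) :=
    fun y _ => WithLp.toLp 2 fun k =>
      if s (E.symm k) = s y then 0
      else ((Finset.univ.filter fun i => E.symm k i ≠ y i).card : ℝ)⁻¹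
  let σ : Cube n → Fin K → EuclideanSpace ℝ (Fin 1) :=
    fun x a => if s x = a then EuclideanSpace.single 0 1 else 0
  refine ⟨relCost u v, _, _, u, v, σ, ⟨fun x y => ?_, fun x a hxa => ?_⟩, rfl⟩
  · have h1 : ∑ a, inner ℝ (σ x a) (σ y a) = if s x = s y then (1 : ℝ) else 0 := by
      rw [Finset.sum_eq_single (s x)]
      · by_cases h : s x = s y
        · simp [σ, h]
        · have h' : ¬ s y = s x := fun e => h e.symm
          simp [σ, h, h']
      · intro b _ hb
        have h' : ¬ s x = b := fun e => hb e.symm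
        simp [σ, h']
      · simp
    rw [h1]
    by_cases h : s x = s y
    · simp [u, v, h, EuclideanSpace.inner_single_left]
    · have hne : x ≠ y := fun e => h (by rw [e])
      obtain ⟨i, hi⟩ := Function.ne_iff.mp hne
      have hc : ((Finset.univ.filter fun i => x i ≠ y i).card : ℝ) ≠ 0 := by
        rw [Nat.cast_ne_zero]
        exact Finset.card_ne_zero_of_mem (Finset.mem_filter.mpr ⟨Finset.mem_univ i, hi⟩)
      simp only [u, v, h, EuclideanSpace.inner_single_left]
      simp only [Equiv.symm_apply_apply, h, if_false, Finset.sum_const, nsmul_eq_mul, map_one,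
        one_mul, sub_zero]
      exact mul_inv_cancel₀ hc
  · have h' : ¬ s x = a := fun e => hxa (e ▸ hs x)
    simp [σ, h']

end RelationalAdversary

section Composition

/-- The `p`-th block `x_p ∈ {0,1}^m` of `x = (x_1, …, x_N) ∈ {0,1}^{Nm}`; with indices starting
at `0`, its `q`-th bit is the bit of `x` at position `p * m + q`. -/
def block {N m : ℕ} (x : Cube (N * m)) (p : Fin N) : Cube m :=
  fun q => x (finProdFinEquiv (p, q))

/-- The string `(g(x_1), …, g(x_N))`. -/
def blockMap {N m : ℕ} (g : Cube m → Bool) (x : Cube (N * m)) : Cube N :=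
  fun p => g (block x p)

/-- The composed relation `f ∘ g^N = {(x, a) | ((g(x_1), …, g(x_N)), a) ∈ f}`. -/
def relComp {N m K : ℕ} (f : Set (Cube N × Fin K)) (g : Cube m → Bool) :
    Set (Cube (N * m) × Fin K) :=
  {xa | (blockMap g xa.1, xa.2) ∈ f}

end Composition

/-! The upper bound tensors feasible points. Let `u`, `v`, `σ` be feasible for `f`, and let vectors
`w` satisfy `∑_{i : x_i ≠ y_i} ⟨w_{x,i}, w_{y,i}⟩ = 1` whenever `g x ≠ g y`. Then `u ⊗ w` and `v ⊗
w`, with one extra tensor factor that kills the blocks where the values of `g` agree, are feasible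
for the composition, and the costs multiply (`advRel_relComp_le_mul`). Such `w` exist at every cost
above `adv g`, by conic duality: a Hahn–Banach separation, then a small correction
(`exists_dual_vectors`).

The lower bound averages a feasible point of the composition (`advRel_mul_norm_le`). An adversary
matrix `Γ ≠ 0` has unit vectors `δ_0`, `δ_1`, supported on the two fibres of `g`, with `δ_bᵀ Γ
δ_{!b} = ‖Γ‖`. Put `M = (1 + Γ/‖Γ‖)^{⊗N}`, which is positive semidefinite, and `ψ_z = ⊗_p δ_{z_p}`.
The weights `ψ_z(x) ψ_w(y) M(x,y)` sum to `1` for all `z, w`, so the weighted sum of the constraints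
at `(x,y)` is a constraint at `(z,w)`. Factoring `M` and the matrices made from `Γ ⊙ diffMatrix q`
turns it back into inner products. Since `‖Γ ⊙ diffMatrix q‖ ≤ 1`, the cost drops by the factor
`‖Γ‖`. -/

section

open scoped Matrix MatrixOrder Matrix.Norms.L2Operator

/-! ### Feasible points in terms of dot products -/

theorem Matrix.dotProduct_self_nonneg_real {ι : Type*} [Fintype ι] (a : ι → ℝ) : 0 ≤ a ⬝ᵥ a :=
  Finset.sum_nonneg fun i _ => mul_self_nonneg (a i)

theorem EuclideanSpace.inner_toLp_eq_dotProduct {ι : Type*} [Fintype ι] (a b : ι → ℝ) :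
    inner ℝ (WithLp.toLp 2 a) (WithLp.toLp 2 b) = a ⬝ᵥ b := by
  simp [PiLp.inner_apply, dotProduct, mul_comm]

theorem EuclideanSpace.inner_eq_dotProduct {ι : Type*} [Fintype ι] (a b : EuclideanSpace ℝ ι) :
    inner ℝ a b = a.ofLp ⬝ᵥ b.ofLp := by
  simp [PiLp.inner_apply, dotProduct, mul_comm]

theorem EuclideanSpace.norm_sq_eq_dotProduct {ι : Type*} [Fintype ι] (a : EuclideanSpace ℝ ι) :
    ‖a‖ ^ 2 = a.ofLp ⬝ᵥ a.ofLp := by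
  rw [← real_inner_self_eq_norm_sq, EuclideanSpace.inner_eq_dotProduct]

/-- A feasible point of the minimization problem for `advRel f`, with vectors indexed by arbitrary
finite types and of objective value at most `c`, bounds `advRel f`. -/
theorem advRel_le_of_dotProduct {n K : ℕ} {f : Set (Cube n × Fin K)} {ι κ : Type*} [Fintype ι]
    [Fintype κ] (u v : Cube n → Fin n → ι → ℝ) (σ : Cube n → Fin K → κ → ℝ) (c : ℝ)
    (h : ∀ x y, ∑ i with x i ≠ y i, u x i ⬝ᵥ v y i = 1 - ∑ a, σ x a ⬝ᵥ σ y a)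
    (hσ : ∀ x a, (x, a) ∉ f → σ x a = 0)
    (hu : ∀ x, ∑ i, u x i ⬝ᵥ u x i ≤ c) (hv : ∀ x, ∑ i, v x i ⬝ᵥ v x i ≤ c) :
    advRel f ≤ c := by
  let E := (Fintype.equivFin ι).symm
  let E' := (Fintype.equivFin κ).symm
  have hE : ∀ a b : ι → ℝ, (a ∘ E) ⬝ᵥ (b ∘ E) = a ⬝ᵥ b := fun a b =>
    Equiv.sum_comp E fun i => a i * b i
  have hE' : ∀ a b : κ → ℝ, (a ∘ E') ⬝ᵥ (b ∘ E') = a ⬝ᵥ b := fun a b =>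
    Equiv.sum_comp E' fun i => a i * b i
  let u' : Cube n → Fin n → EuclideanSpace ℝ (Fin (Fintype.card ι)) :=
    fun x i => WithLp.toLp 2 (u x i ∘ E)
  let v' : Cube n → Fin n → EuclideanSpace ℝ (Fin (Fintype.card ι)) :=
    fun x i => WithLp.toLp 2 (v x i ∘ E)
  let σ' : Cube n → Fin K → EuclideanSpace ℝ (Fin (Fintype.card κ)) :=
    fun x a => WithLp.toLp 2 (σ x a ∘ E')
  have hmem : relCost u' v' ∈ advRelValues f := by
    refine ⟨_, _, u', v', σ', ⟨fun x y => ?_, fun x a hxa => ?_⟩, rfl⟩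
    · simp only [u', v', σ', EuclideanSpace.inner_toLp_eq_dotProduct, hE, hE', h]
    · simp only [σ', EuclideanSpace.norm_sq_eq_dotProduct, hE', hσ x a hxa, zero_dotProduct]
  refine (csInf_le (advRelValues_bddBelow f) hmem).trans ?_
  refine max_le (Finset.sup'_le _ _ fun x _ => ?_) (Finset.sup'_le _ _ fun x _ => ?_)
  · simpa only [u', EuclideanSpace.norm_sq_eq_dotProduct, hE] using hu x
  · simpa only [v', EuclideanSpace.norm_sq_eq_dotProduct, hE] using hv x

theorem exists_dotProduct_of_mem_advRelValues {n K : ℕ} {f : Set (Cube n × Fin K)} {c : ℝ}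
    (hc : c ∈ advRelValues f) :
    ∃ (d e : ℕ) (u v : Cube n → Fin n → Fin d → ℝ) (σ : Cube n → Fin K → Fin e → ℝ),
      (∀ x y, ∑ i with x i ≠ y i, u x i ⬝ᵥ v y i = 1 - ∑ a, σ x a ⬝ᵥ σ y a) ∧
      (∀ x a, (x, a) ∉ f → σ x a = 0) ∧
      (∀ x, ∑ i, u x i ⬝ᵥ u x i ≤ c) ∧ ∀ x, ∑ i, v x i ⬝ᵥ v x i ≤ c := by
  obtain ⟨d, e, u, v, σ, ⟨h, hσ⟩, rfl⟩ := hc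
  refine ⟨d, e, fun x i => (u x i).ofLp, fun x i => (v x i).ofLp, fun x a => (σ x a).ofLp,
    fun x y => ?_, fun x a hxa => ?_, fun x => ?_, fun x => ?_⟩
  · simpa only [EuclideanSpace.inner_eq_dotProduct] using h x y
  · have := hσ x a hxa
    rwa [EuclideanSpace.norm_sq_eq_dotProduct, dotProduct_self_eq_zero] at this
  · simp only [← EuclideanSpace.norm_sq_eq_dotProduct]
    exact (Finset.le_sup' (fun x => ∑ i, ‖u x i‖ ^ 2) (Finset.mem_univ x)).trans (le_max_left _ _)
  · simp only [← EuclideanSpace.norm_sq_eq_dotProduct]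
    exact (Finset.le_sup' (fun x => ∑ i, ‖v x i‖ ^ 2) (Finset.mem_univ x)).trans (le_max_right _ _)

theorem nonneg_of_mem_advRelValues {n K : ℕ} {f : Set (Cube n × Fin K)} {c : ℝ}
    (hc : c ∈ advRelValues f) : 0 ≤ c := by
  obtain ⟨d, e, u, v, σ, -, rfl⟩ := hc
  refine le_max_of_le_left (Finset.le_sup'_of_le _ (Finset.mem_univ fun _ => false) ?_)
  positivity

theorem advRel_nonneg {n K : ℕ} (f : Set (Cube n × Fin K)) : 0 ≤ advRel f :=
  Real.sInf_nonneg fun _ => nonneg_of_mem_advRelValues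

theorem IsTotalRel.relComp {N m K : ℕ} {f : Set (Cube N × Fin K)} (hf : IsTotalRel f)
    (g : Cube m → Bool) : IsTotalRel (relComp f g) :=
  fun x => hf (blockMap g x)

theorem sum_fin_mul {N m : ℕ} (F : Fin (N * m) → ℝ) :
    ∑ i, F i = ∑ p, ∑ q, F (finProdFinEquiv (p, q)) := by
  rw [← Equiv.sum_comp finProdFinEquiv, Fintype.sum_prod_type]

/-! ### Upper bound: tensor products of feasible points -/

theorem dotProduct_prod_mul {ι κ : Type*} [Fintype ι] [Fintype κ] (a b : ι → ℝ) (c d : κ → ℝ) :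
    (fun k : ι × κ => a k.1 * c k.2) ⬝ᵥ (fun k : ι × κ => b k.1 * d k.2) =
      (a ⬝ᵥ b) * (c ⬝ᵥ d) := by
  simp only [dotProduct, Fintype.sum_prod_type, Finset.sum_mul_sum]
  exact Finset.sum_congr rfl fun _ _ => Finset.sum_congr rfl fun _ _ => by ring

/-- A feasible point of the relational problem for `f` and a feasible point of the vector problem
dual to `adv g` compose by tensor products. -/
theorem advRel_relComp_le_mul {N m K : ℕ} {f : Set (Cube N × Fin K)} {g : Cube m → Bool}
    {ι : Type*} [Fintype ι] (w : Cube m → Fin m → ι → ℝ) {A c : ℝ}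
    (hw : ∀ x y, g x ≠ g y → ∑ i with x i ≠ y i, w x i ⬝ᵥ w y i = 1)
    (hA : ∀ x, ∑ i, w x i ⬝ᵥ w x i ≤ A) (hA0 : 0 ≤ A) (hc : c ∈ advRelValues f) :
    advRel (relComp f g) ≤ c * A := by
  obtain ⟨d, e, u, v, σ, h, hσ, hu, hv⟩ := exists_dotProduct_of_mem_advRelValues hc
  -- The vectors `w` are unconstrained when `g x = g y`. Pairing `τ b` on the `u` side with `τ
  -- (!b')` on the `v` side removes exactly those blocks; as unit vectors they leave the cost
  -- unchanged.
  let τ : Bool → Bool → ℝ := fun b k => if b = k then 1 else 0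
  have hτ : ∀ b b' : Bool, τ b ⬝ᵥ τ (!b') = if b ≠ b' then 1 else 0 := by
    intro b b'
    cases b <;> cases b' <;> simp [τ, dotProduct]
  have hτ' : ∀ b : Bool, τ b ⬝ᵥ τ b = 1 := by
    intro b
    cases b <;> simp [τ, dotProduct]
  let r : Fin (N * m) → Fin N := fun i => (finProdFinEquiv.symm i).1
  let s : Fin (N * m) → Fin m := fun i => (finProdFinEquiv.symm i).2
  refine advRel_le_of_dotProduct
    (fun x i => fun k : (Fin d × ι) × Bool =>
      (u (blockMap g x) (r i) k.1.1 * w (block x (r i)) (s i) k.1.2) *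
        τ (blockMap g x (r i)) k.2)
    (fun x i => fun k : (Fin d × ι) × Bool =>
      (v (blockMap g x) (r i) k.1.1 * w (block x (r i)) (s i) k.1.2) *
        τ (!(blockMap g x (r i))) k.2)
    (fun x a => σ (blockMap g x) a) (c * A) (fun x y => ?_) (fun x a hxa => hσ _ _ hxa)
    (fun x => ?_) (fun x => ?_)
  · rw [← h, Finset.sum_filter, Finset.sum_filter, sum_fin_mul]
    refine Finset.sum_congr rfl fun p _ => ?_
    simp only [r, s, Equiv.symm_apply_apply]
    have := fun q : Fin m => dotProduct_prod_mul
      (fun k : Fin d × ι => u (blockMap g x) p k.1 * w (block x p) q k.2)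
      (fun k : Fin d × ι => v (blockMap g y) p k.1 * w (block y p) q k.2)
      (τ (blockMap g x p)) (τ (!(blockMap g y p)))
    simp only [this, dotProduct_prod_mul, hτ]
    by_cases hp : blockMap g x p = blockMap g y p
    · simp [hp]
    · have h1 := hw (block x p) (block y p) hp
      rw [Finset.sum_filter] at h1
      simp only [block] at h1
      simp only [hp, ne_eq, not_false_eq_true, if_true, mul_one]
      refine Eq.trans ?_ (mul_one _)
      rw [← h1, Finset.mul_sum]
      exact Finset.sum_congr rfl fun q _ => (mul_ite_zero _ _ _).symm
  · rw [sum_fin_mul]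
    simp only [r, s, Equiv.symm_apply_apply]
    have := fun (p : Fin N) (q : Fin m) => dotProduct_prod_mul
      (fun k : Fin d × ι => u (blockMap g x) p k.1 * w (block x p) q k.2)
      (fun k : Fin d × ι => u (blockMap g x) p k.1 * w (block x p) q k.2)
      (τ (blockMap g x p)) (τ (blockMap g x p))
    simp only [this, dotProduct_prod_mul, hτ', mul_one, ← Finset.mul_sum]
    refine le_trans ?_ (mul_le_mul_of_nonneg_right (hu (blockMap g x)) hA0)
    rw [Finset.sum_mul]
    exact Finset.sum_le_sum fun p _ =>
      mul_le_mul_of_nonneg_left (hA _) (Matrix.dotProduct_self_nonneg_real _)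
  · rw [sum_fin_mul]
    simp only [r, s, Equiv.symm_apply_apply]
    have := fun (p : Fin N) (q : Fin m) => dotProduct_prod_mul
      (fun k : Fin d × ι => v (blockMap g x) p k.1 * w (block x p) q k.2)
      (fun k : Fin d × ι => v (blockMap g x) p k.1 * w (block x p) q k.2)
      (τ (!(blockMap g x p))) (τ (!(blockMap g x p)))
    simp only [this, dotProduct_prod_mul, hτ', mul_one, ← Finset.mul_sum]
    refine le_trans ?_ (mul_le_mul_of_nonneg_right (hv (blockMap g x)) hA0)
    rw [Finset.sum_mul]
    exact Finset.sum_le_sum fun p _ =>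
      mul_le_mul_of_nonneg_left (hA _) (Matrix.dotProduct_self_nonneg_real _)

/-! ### Spectral norm, quadratic forms and positive semidefinite matrices -/

theorem Matrix.mulVec_dotProduct_self_le {X : Type*} [Fintype X] [DecidableEq X] (A : Matrix X X ℝ)
    (v : X → ℝ) : (A *ᵥ v) ⬝ᵥ (A *ᵥ v) ≤ ‖A‖ ^ 2 * (v ⬝ᵥ v) := by
  have h := Matrix.l2_opNorm_mulVec A (WithLp.toLp 2 v)
  have h2 := pow_le_pow_left₀ (norm_nonneg _) h 2
  rw [mul_pow, EuclideanSpace.norm_sq_eq_dotProduct, EuclideanSpace.norm_sq_eq_dotProduct] at h2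
  exact h2

theorem Matrix.abs_dotProduct_mulVec_self_le {X : Type*} [Fintype X] [DecidableEq X]
    (A : Matrix X X ℝ) (v : X → ℝ) : |v ⬝ᵥ (A *ᵥ v)| ≤ ‖A‖ * (v ⬝ᵥ v) := by
  have h := abs_real_inner_le_norm (WithLp.toLp 2 v) (WithLp.toLp 2 (A *ᵥ v))
  rw [EuclideanSpace.inner_toLp_eq_dotProduct] at h
  refine h.trans ?_
  have h2 := Matrix.l2_opNorm_mulVec A (WithLp.toLp 2 v)
  have h3 := EuclideanSpace.norm_sq_eq_dotProduct (WithLp.toLp 2 v)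
  change _ = v ⬝ᵥ v at h3
  rw [← h3]
  calc _ ≤ ‖WithLp.toLp 2 v‖ * (‖A‖ * ‖WithLp.toLp 2 v‖) :=
        mul_le_mul_of_nonneg_left h2 (norm_nonneg _)
    _ = _ := by ring

theorem Matrix.l2_opNorm_le_one_of_dotProduct {X : Type*} [Fintype X] [DecidableEq X]
    {A : Matrix X X ℝ} (h : ∀ v, (A *ᵥ v) ⬝ᵥ (A *ᵥ v) ≤ v ⬝ᵥ v) : ‖A‖ ≤ 1 := by
  rw [Matrix.cstar_norm_def]
  refine ContinuousLinearMap.opNorm_le_bound _ zero_le_one fun v => ?_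
  rw [one_mul]
  refine le_of_sq_le_sq ?_ (norm_nonneg _)
  rw [EuclideanSpace.norm_sq_eq_dotProduct, EuclideanSpace.norm_sq_eq_dotProduct,
    Matrix.ofLp_toEuclideanCLM]
  exact h _

theorem Matrix.IsSymm.dotProduct_mulVec_comm {X : Type*} [Fintype X] {A : Matrix X X ℝ}
    (hA : A.IsSymm) (v w : X → ℝ) : v ⬝ᵥ (A *ᵥ w) = w ⬝ᵥ (A *ᵥ v) := by
  rw [Matrix.dotProduct_mulVec, ← Matrix.mulVec_transpose, hA.eq, dotProduct_comm]

/-- A real symmetric matrix whose quadratic form is bounded by `1` has spectral norm at most `1`. -/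
theorem Matrix.IsSymm.l2_opNorm_le_one {X : Type*} [Fintype X] [DecidableEq X]
    {A : Matrix X X ℝ} (hA : A.IsSymm) (h : ∀ v, |v ⬝ᵥ (A *ᵥ v)| ≤ v ⬝ᵥ v) : ‖A‖ ≤ 1 := by
  refine Matrix.l2_opNorm_le_one_of_dotProduct fun v => ?_
  -- Polarization: the forms at `Av + v` and `Av - v` differ by `4‖Av‖²`, while the hypothesis
  -- bounds this difference by `2‖Av‖² + 2‖v‖²`.
  have h1 := (abs_le.mp (h (A *ᵥ v + v))).2
  have h2 := (abs_le.mp (h (A *ᵥ v - v))).1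
  have h3 := hA.dotProduct_mulVec_comm v (A *ᵥ v)
  simp only [Matrix.mulVec_add, Matrix.mulVec_sub, dotProduct_add, add_dotProduct,
    dotProduct_sub, sub_dotProduct] at h1 h2
  have h4 := dotProduct_comm v (A *ᵥ v)
  linarith

theorem Matrix.posSemidef_real_iff {X : Type*} [Fintype X] {A : Matrix X X ℝ} :
    A.PosSemidef ↔ A.IsSymm ∧ ∀ v, 0 ≤ v ⬝ᵥ (A *ᵥ v) := by
  rw [Matrix.posSemidef_iff_dotProduct_mulVec]
  simp [Matrix.IsHermitian, Matrix.IsSymm, Matrix.conjTranspose_eq_transpose_of_trivial]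

theorem Matrix.PosSemidef.exists_transpose_mul_self {X : Type*} [Fintype X] [DecidableEq X]
    {A : Matrix X X ℝ} (hA : A.PosSemidef) : ∃ B : Matrix X X ℝ, A = Bᵀ * B := by
  obtain ⟨B, hB⟩ := CStarAlgebra.nonneg_iff_eq_star_mul_self.mp hA.nonneg
  exact ⟨B, by rw [hB, Matrix.star_eq_conjTranspose, Matrix.conjTranspose_eq_transpose_of_trivial]⟩

/-- In finite dimension the unit sphere is compact, so the operator norm is attained. -/
theorem Matrix.exists_dotProduct_mulVec_self_eq {X : Type*} [Fintype X] [DecidableEq X]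
    [Nonempty X] (A : Matrix X X ℝ) :
    ∃ v : X → ℝ, v ⬝ᵥ v = 1 ∧ (A *ᵥ v) ⬝ᵥ (A *ᵥ v) = ‖A‖ ^ 2 := by
  let T := Matrix.toEuclideanCLM (n := X) (𝕜 := ℝ) A
  obtain ⟨v, hv, hmax⟩ := (isCompact_sphere (0 : EuclideanSpace ℝ X) 1).exists_isMaxOn
    (NormedSpace.sphere_nonempty.mpr zero_le_one) (f := fun v => ‖T v‖)
    (by fun_prop)
  have hv1 : ‖v‖ = 1 := by simpa using hv
  have hT : ‖T‖ ≤ ‖T v‖ := by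
    refine ContinuousLinearMap.opNorm_le_bound _ (norm_nonneg _) fun w => ?_
    by_cases hw : w = 0
    · simp [hw]
    have hw' : ‖w‖ ≠ 0 := norm_ne_zero_iff.mpr hw
    have := hmax (a := ‖w‖⁻¹ • w) (by simp [norm_smul, hw'])
    simp only [Set.mem_ofPred_eq, map_smul, norm_smul, norm_inv, norm_norm] at this
    rwa [inv_mul_le_iff₀ (by positivity), mul_comm] at this
  have hT' : ‖T v‖ = ‖A‖ := le_antisymm ((T.le_opNorm v).trans (by rw [hv1, mul_one]; rfl)) hT
  refine ⟨v.ofLp, ?_, ?_⟩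
  · rw [← EuclideanSpace.norm_sq_eq_dotProduct, hv1, one_pow]
  · rw [← hT', EuclideanSpace.norm_sq_eq_dotProduct, Matrix.ofLp_toEuclideanCLM]

/-! ### Singular vectors of an adversary matrix -/

/-- A pair of singular vectors for the largest singular value of an adversary matrix, one supported
on `g⁻¹(0)` and the other one on `g⁻¹(1)`. -/
theorem IsAdversaryMatrix.exists_singular_vectors {m : ℕ} {g : Cube m → Bool}
    {Γ : Matrix (Cube m) (Cube m) ℝ} (hΓ : IsAdversaryMatrix g Γ) (h0 : 0 < ‖Γ‖) :
    ∃ δ : Bool → Cube m → ℝ, (∀ b x, g x ≠ b → δ b x = 0) ∧ (∀ b, δ b ⬝ᵥ δ b = 1) ∧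
      ∀ b, δ b ⬝ᵥ (Γ *ᵥ δ (!b)) = ‖Γ‖ := by
  obtain ⟨v, hv1, hv⟩ := Γ.exists_dotProduct_mulVec_self_eq
  -- `Γ` exchanges the two fibres of `g`, so the parts `r b` of a norm-attaining vector have
  -- orthogonal images. Each part satisfies the norm inequality and their sum attains equality,
  -- hence each part does. Any nonzero part then yields one singular vector, and its image under `Γ`
  -- the other.
  let r : Bool → Cube m → ℝ := fun b x => if g x = b then v x else 0
  have hr : v = r true + r false := by
    funext x
    cases h : g x <;> simp [r, h]
  have horth : ∀ a b : Cube m → ℝ, (∀ x, a x * b x = 0) → a ⬝ᵥ b = 0 := fun a b h =>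
    Finset.sum_eq_zero fun x _ => h x
  have hsupp : ∀ (b : Bool) (a : Cube m → ℝ), (∀ x, g x ≠ b → a x = 0) →
      ∀ x, g x = b → (Γ *ᵥ a) x = 0 := by
    intro b a ha x hx
    refine Finset.sum_eq_zero fun y _ => ?_
    change Γ x y * a y = 0
    by_cases hy : g y = b
    · rw [hΓ.2 x y (hx.trans hy.symm), zero_mul]
    · rw [ha y hy, mul_zero]
  have hrs : ∀ b x, g x ≠ b → r b x = 0 := fun b x hx => if_neg hx
  have hvr : v ⬝ᵥ v = r true ⬝ᵥ r true + r false ⬝ᵥ r false := by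
    have h1 : r true ⬝ᵥ r false = 0 := horth _ _ fun x => by cases h : g x <;> simp [r, h]
    have h2 : r false ⬝ᵥ r true = 0 := horth _ _ fun x => by cases h : g x <;> simp [r, h]
    rw [hr, add_dotProduct, dotProduct_add, dotProduct_add, h1, h2]
    ring
  have hΓvr : (Γ *ᵥ v) ⬝ᵥ (Γ *ᵥ v) = (Γ *ᵥ r true) ⬝ᵥ (Γ *ᵥ r true) +
      (Γ *ᵥ r false) ⬝ᵥ (Γ *ᵥ r false) := by
    have h1 : (Γ *ᵥ r true) ⬝ᵥ (Γ *ᵥ r false) = 0 := horth _ _ fun x => by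
      cases h : g x
      · rw [hsupp false _ (hrs false) x h, mul_zero]
      · rw [hsupp true _ (hrs true) x h, zero_mul]
    rw [hr, Matrix.mulVec_add, add_dotProduct, dotProduct_add, dotProduct_add, h1,
      dotProduct_comm (Γ *ᵥ r false), h1]
    ring
  have hle := fun b => Γ.mulVec_dotProduct_self_le (r b)
  have heq : ∀ b, (Γ *ᵥ r b) ⬝ᵥ (Γ *ᵥ r b) = ‖Γ‖ ^ 2 * (r b ⬝ᵥ r b) := by
    have h1 := hle true
    have h2 := hle false
    have h3 : ‖Γ‖ ^ 2 * (r true ⬝ᵥ r true + r false ⬝ᵥ r false) = ‖Γ‖ ^ 2 := by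
      rw [← hvr, hv1, mul_one]
    intro b
    cases b <;> linarith
  obtain ⟨b, hb⟩ : ∃ b, 0 < r b ⬝ᵥ r b := by
    by_contra! hcon
    have := hcon true
    have := hcon false
    linarith
  let c := r b ⬝ᵥ r b
  have hsq : √c * √c = c := Real.mul_self_sqrt hb.le
  have hinv : (√c)⁻¹ * ((√c)⁻¹ * c) = 1 := by
    rw [← mul_assoc, ← mul_inv, hsq, inv_mul_cancel₀ hb.ne']
  let α : Cube m → ℝ := (√c)⁻¹ • r b
  let β : Cube m → ℝ := ‖Γ‖⁻¹ • (Γ *ᵥ α)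
  have hα : α ⬝ᵥ α = 1 := by
    simp only [α, smul_dotProduct, dotProduct_smul, smul_eq_mul]
    exact hinv
  have hΓα : (Γ *ᵥ α) ⬝ᵥ (Γ *ᵥ α) = ‖Γ‖ ^ 2 := by
    simp only [α, Matrix.mulVec_smul, smul_dotProduct, dotProduct_smul, smul_eq_mul, heq]
    rw [mul_left_comm _ (‖Γ‖ ^ 2), mul_left_comm _ (‖Γ‖ ^ 2)]
    exact (congrArg _ hinv).trans (mul_one _)
  have hβ : β ⬝ᵥ β = 1 := by
    simp only [β, smul_dotProduct, dotProduct_smul, smul_eq_mul, hΓα]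
    field_simp
  have hβα : β ⬝ᵥ (Γ *ᵥ α) = ‖Γ‖ := by
    simp only [β, smul_dotProduct, smul_eq_mul, hΓα]
    field_simp
  have hαs : ∀ x, g x ≠ b → α x = 0 := fun x hx => by simp [α, hrs b x hx]
  have hβs : ∀ x, g x = b → β x = 0 := fun x hx => by simp [β, hsupp b α hαs x hx]
  refine ⟨fun b' => if b' = b then α else β, fun b' x hx => ?_, fun b' => ?_, fun b' => ?_⟩
  · by_cases h : b' = b
    · simp only [h, if_true]
      exact hαs x (h ▸ hx)
    · simp only [h, if_false]
      refine hβs x ?_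
      revert hx h
      cases g x <;> cases b <;> cases b' <;> simp
  · by_cases h : b' = b <;> simp [h, hα, hβ]
  · by_cases h : b' = b
    · have h' : (!b') ≠ b := by rw [h]; simp
      simp only [h, if_true, Bool.not_eq_self, if_false]
      rw [hΓ.1.dotProduct_mulVec_comm, hβα]
    · have h' : (!b') = b := by
        revert h
        cases b <;> cases b' <;> simp
      simp only [h, h', if_true, if_false, hβα]

/-! ### Kronecker products of families of matrices -/

/-- The Kronecker product of a finite family of square matrices. -/
def piKronecker {ι X : Type*} [Fintype ι] (S : ι → Matrix X X ℝ) : Matrix (ι → X) (ι → X) ℝ :=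
  Matrix.of fun k x => ∏ p, S p (k p) (x p)

theorem piKronecker_apply {ι X : Type*} [Fintype ι] (S : ι → Matrix X X ℝ) (k x : ι → X) :
    piKronecker S k x = ∏ p, S p (k p) (x p) := rfl

section PiKronecker

variable {ι X : Type*} [Fintype ι] [DecidableEq ι] [Fintype X]

theorem piKronecker_transpose_mul (S T : ι → Matrix X X ℝ) :
    (piKronecker S)ᵀ * piKronecker T = piKronecker fun p => (S p)ᵀ * T p := by
  ext x y
  simp only [Matrix.mul_apply, Matrix.transpose_apply, piKronecker_apply, Finset.prod_univ_sum,
    Fintype.piFinset_univ, Finset.prod_mul_distrib]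

theorem mulVec_dotProduct_mulVec {Y : Type*} [Fintype Y] (A B : Matrix Y Y ℝ) (φ χ : Y → ℝ) :
    (A *ᵥ φ) ⬝ᵥ (B *ᵥ χ) = ∑ x, ∑ y, φ x * χ y * (Aᵀ * B) x y := by
  rw [Matrix.dotProduct_mulVec, Matrix.vecMul_mulVec, ← Matrix.dotProduct_mulVec]
  simp only [dotProduct, Matrix.mulVec, Finset.mul_sum]
  exact Finset.sum_congr rfl fun x _ => Finset.sum_congr rfl fun y _ => by ring

variable [DecidableEq X]

/-- On vectors supported on a fibre of `x ↦ (g (x p))ₚ`, a Kronecker product of matrices with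
orthonormal columns within each fibre of `g`, except for one factor that is a contraction, acts as a
contraction. -/
theorem piKronecker_mulVec_dotProduct_self_le {β : Type*} (g : X → β) (T : ι → Matrix X X ℝ) (p : ι)
    (hT : ∀ p', p' ≠ p → ∀ x y, g x = g y → ((T p')ᵀ * T p') x y = (1 : Matrix X X ℝ) x y)
    (hp : (1 - (T p)ᵀ * T p).PosSemidef) (z : ι → β) (φ : (ι → X) → ℝ)
    (hφ : ∀ x, φ x ≠ 0 → ∀ p, g (x p) = z p) :
    (piKronecker T *ᵥ φ) ⬝ᵥ (piKronecker T *ᵥ φ) ≤ φ ⬝ᵥ φ := by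
  -- `E` completes the contraction `T p` to an isometry: `EᵀE + (T p)ᵀ(T p) = 1`. Putting `E` in
  -- place of factor `p` gives a second Kronecker product, and on the fibre of `z` the two squared
  -- norms add up to that of `φ`.
  obtain ⟨E, hE⟩ := hp.exists_transpose_mul_self
  let T' := Function.update T p E
  have h0 := Matrix.dotProduct_self_nonneg_real (piKronecker T' *ᵥ φ)
  have hsum : (piKronecker T' *ᵥ φ) ⬝ᵥ (piKronecker T' *ᵥ φ) +
      (piKronecker T *ᵥ φ) ⬝ᵥ (piKronecker T *ᵥ φ) = φ ⬝ᵥ φ := by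
    simp only [mulVec_dotProduct_mulVec, piKronecker_transpose_mul, ← Finset.sum_add_distrib,
      ← mul_add, piKronecker_apply]
    refine Finset.sum_congr rfl fun x _ => ?_
    have key : ∀ y, φ x * φ y * (∏ p', ((T' p')ᵀ * T' p') (x p') (y p') +
        ∏ p', ((T p')ᵀ * T p') (x p') (y p')) = if y = x then φ x * φ x else 0 := by
      intro y
      by_cases hx : φ x = 0
      · simp [hx]
      by_cases hy : φ y = 0
      · by_cases hxy : y = x
        · exact absurd (hxy ▸ hy) hx
        · simp [hy, hxy]
      have hg : ∀ p', g (x p') = g (y p') := fun p' => (hφ x hx p').trans (hφ y hy p').symm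
      have h1 : ∏ p', ((T' p')ᵀ * T' p') (x p') (y p') + ∏ p', ((T p')ᵀ * T p') (x p') (y p') =
          ∏ p', (1 : Matrix X X ℝ) (x p') (y p') := by
        have hrest : ∀ p' ∈ Finset.univ.erase p, ((T p')ᵀ * T p') (x p') (y p') =
            (1 : Matrix X X ℝ) (x p') (y p') := fun p' hp' =>
          hT p' (Finset.ne_of_mem_erase hp') _ _ (hg p')
        have hrest' : ∀ p' ∈ Finset.univ.erase p, ((T' p')ᵀ * T' p') (x p') (y p') =
            (1 : Matrix X X ℝ) (x p') (y p') := fun p' hp' => by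
          rw [← hrest p' hp']
          simp only [T', Function.update_of_ne (Finset.ne_of_mem_erase hp')]
        rw [← Finset.mul_prod_erase _ _ (Finset.mem_univ p),
          ← Finset.mul_prod_erase _ (fun p' => ((T p')ᵀ * T p') (x p') (y p')) (Finset.mem_univ p),
          ← Finset.mul_prod_erase _ (fun p' => (1 : Matrix X X ℝ) (x p') (y p'))
            (Finset.mem_univ p), Finset.prod_congr rfl hrest, Finset.prod_congr rfl hrest',
          ← add_mul]
        congr 1
        simp only [T', Function.update_self, ← hE, Matrix.sub_apply, sub_add_cancel]
      rw [h1]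
      obtain rfl | hxy := eq_or_ne y x
      · simp only [Matrix.one_apply_eq, Finset.prod_const_one, mul_one, if_true]
      · obtain ⟨p', hp'⟩ := Function.ne_iff.mp hxy
        have h2 : (1 : Matrix X X ℝ) (x p') (y p') = 0 := Matrix.one_apply_ne (Ne.symm hp')
        rw [Finset.prod_eq_zero (Finset.mem_univ p') h2, mul_zero, if_neg hxy]
    simp only [key, Finset.sum_ite_eq', Finset.mem_univ, if_true]
  linarith

end PiKronecker

/-! ### Lower bound: averaging along singular vectors -/

/-- Strings of length `N * m` as families of `N` blocks. -/
def blockEquiv (N m : ℕ) : Cube (N * m) ≃ (Fin N → Cube m) :=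
  (Equiv.arrowCongr finProdFinEquiv.symm (Equiv.refl Bool)).trans (Equiv.curry _ _ _)

theorem blockEquiv_apply {N m : ℕ} (x : Cube (N * m)) : blockEquiv N m x = block x := by
  rfl

theorem blockEquiv_symm_apply {N m : ℕ} (x : Fin N → Cube m) (p : Fin N) (q : Fin m) :
    (blockEquiv N m).symm x (finProdFinEquiv (p, q)) = x p q := by
  have h := (blockEquiv N m).apply_symm_apply x
  rw [blockEquiv_apply] at h
  exact congrFun (congrFun h p) q

theorem blockMap_blockEquiv_symm {N m : ℕ} (g : Cube m → Bool) (x : Fin N → Cube m) :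
    blockMap g ((blockEquiv N m).symm x) = fun p => g (x p) := by
  funext p
  have h := (blockEquiv N m).apply_symm_apply x
  rw [blockEquiv_apply] at h
  simp only [blockMap, h]

/-- Used to read a weighted double sum of inner products, with weight matrix factored as `Aᵀ * B`,
as a single inner product of transformed vectors. -/
theorem sum_mulVec_dotProduct_mulVec {Y J : Type*} [Fintype Y] [Fintype J] (A B : Matrix Y Y ℝ)
    (φ χ : Y → ℝ) (U V : Y → J → ℝ) :
    ∑ j, (A *ᵥ fun x => φ x * U x j) ⬝ᵥ (B *ᵥ fun y => χ y * V y j) =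
      ∑ x, ∑ y, φ x * χ y * (Aᵀ * B) x y * (U x ⬝ᵥ V y) := by
  simp only [mulVec_dotProduct_mulVec]
  simp only [dotProduct, Finset.mul_sum]
  rw [Finset.sum_comm]
  refine Finset.sum_congr rfl fun x _ => ?_
  rw [Finset.sum_comm]
  exact Finset.sum_congr rfl fun y _ => Finset.sum_congr rfl fun j _ => by ring

theorem Matrix.posSemidef_one_sub_transpose_mul_self {X : Type*} [Fintype X] [DecidableEq X]
    {A : Matrix X X ℝ} (hA : ‖A‖ ≤ 1) : (1 - Aᵀ * A).PosSemidef := by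
  rw [Matrix.posSemidef_real_iff]
  refine ⟨by simp [Matrix.IsSymm], fun v => ?_⟩
  have h := A.mulVec_dotProduct_self_le v
  have h2 : ‖A‖ ^ 2 * (v ⬝ᵥ v) ≤ v ⬝ᵥ v :=
    mul_le_of_le_one_left (Matrix.dotProduct_self_nonneg_real v) (pow_le_one₀ (norm_nonneg _) hA)
  have h3 : v ⬝ᵥ ((Aᵀ * A) *ᵥ v) = (A *ᵥ v) ⬝ᵥ (A *ᵥ v) := by
    rw [← Matrix.mulVec_mulVec, Matrix.dotProduct_mulVec, Matrix.vecMul_transpose]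
  rw [Matrix.sub_mulVec, Matrix.one_mulVec, dotProduct_sub, h3]
  linarith

/-- The quadratic form of `A` is at least `-‖A‖` times the squared length. For an adversary matrix,
the result agrees with the identity inside the fibres of `g` and with `Γ/‖Γ‖` across them. -/
theorem Matrix.IsSymm.posSemidef_one_add_inv_norm_smul {X : Type*} [Fintype X] [DecidableEq X]
    {A : Matrix X X ℝ} (hA : A.IsSymm) (h0 : 0 < ‖A‖) : (1 + ‖A‖⁻¹ • A).PosSemidef := by
  rw [Matrix.posSemidef_real_iff]
  refine ⟨by simp [Matrix.IsSymm, hA.eq], fun v => ?_⟩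
  have h := (abs_le.mp (A.abs_dotProduct_mulVec_self_le v)).1
  rw [Matrix.add_mulVec, Matrix.one_mulVec, dotProduct_add, Matrix.smul_mulVec, dotProduct_smul,
    smul_eq_mul]
  have h2 : ‖A‖⁻¹ * (-(‖A‖ * (v ⬝ᵥ v))) ≤ ‖A‖⁻¹ * (v ⬝ᵥ (A *ᵥ v)) :=
    mul_le_mul_of_nonneg_left h (inv_nonneg.mpr h0.le)
  rw [mul_neg, inv_mul_cancel_left₀ h0.ne'] at h2
  linarith

/-- A feasible point of the relational problem for `f ∘ g^N` is contracted along the singular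
vectors of an adversary matrix of `g` to a feasible point of the problem for `f`. -/
theorem advRel_mul_norm_le {N m K : ℕ} {f : Set (Cube N × Fin K)} {g : Cube m → Bool}
    {Γ : Matrix (Cube m) (Cube m) ℝ} (hΓ : IsAdversaryMatrix g Γ)
    (hD : ∀ i, ‖Γ ⊙ diffMatrix i‖ ≤ 1) {c : ℝ} (hc : c ∈ advRelValues (relComp f g)) :
    advRel f * ‖Γ‖ ≤ c := by
  obtain h0 | h0 := (norm_nonneg Γ).eq_or_lt
  · rw [← h0, mul_zero]
    exact nonneg_of_mem_advRelValues hc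
  rw [← le_div_iff₀ h0]
  obtain ⟨d, e, u, v, σ, h, hσ, hu, hv⟩ := exists_dotProduct_of_mem_advRelValues hc
  obtain ⟨δ, hδ, hδ1, hδΓ⟩ := hΓ.exists_singular_vectors h0
  obtain ⟨R, hR⟩ := (hΓ.1.posSemidef_one_add_inv_norm_smul h0).exists_transpose_mul_self
  have hM₁ : ∀ x y, g x = g y → (Rᵀ * R) x y = (1 : Matrix (Cube m) (Cube m) ℝ) x y := by
    intro x y hxy
    rw [← hR, Matrix.add_apply, Matrix.smul_apply, hΓ.2 x y hxy, smul_zero, add_zero]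
  have hM₁' : ∀ x y, g x ≠ g y → (Rᵀ * R) x y = ‖Γ‖⁻¹ * Γ x y := by
    intro x y hxy
    have hne : x ≠ y := fun e => hxy (congrArg g e)
    rw [← hR, Matrix.add_apply, Matrix.smul_apply, Matrix.one_apply_ne hne, zero_add, smul_eq_mul]
  let M : (Fin N → Cube m) → (Fin N → Cube m) → ℝ := fun x y => ∏ p, (Rᵀ * R) (x p) (y p)
  let ψ : Cube N → (Fin N → Cube m) → ℝ := fun z x => ∏ p, δ (z p) (x p)
  have hψ : ∀ z x, ψ z x ≠ 0 → ∀ p, g (x p) = z p := by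
    intro z x hx p
    by_contra hp
    exact hx (Finset.prod_eq_zero (Finset.mem_univ p) (hδ _ _ hp))
  have hψψ : ∀ z, ∑ x, ψ z x * ψ z x = 1 := by
    intro z
    simp only [ψ, ← Finset.prod_mul_distrib]
    have := Finset.prod_univ_sum (fun _ : Fin N => (Finset.univ : Finset (Cube m)))
      fun p x => δ (z p) x * δ (z p) x
    rw [Fintype.piFinset_univ] at this
    rw [← this]
    exact Finset.prod_eq_one fun p _ => hδ1 (z p)
  -- For `b = b'` only the identity contributes, since `Γ` vanishes inside a fibre; for `b ≠ b'`
  -- only `Γ/‖Γ‖` does, since the supports are disjoint.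
  have hδM : ∀ b b', ∑ x, ∑ y, δ b x * δ b' y * (Rᵀ * R) x y = 1 := by
    intro b b'
    rw [← mulVec_dotProduct_mulVec, Matrix.dotProduct_mulVec, Matrix.vecMul_mulVec,
      ← Matrix.dotProduct_mulVec, ← hR, Matrix.add_mulVec, Matrix.one_mulVec, Matrix.smul_mulVec,
      dotProduct_add, dotProduct_smul, smul_eq_mul]
    have hz : ∀ a, δ a ⬝ᵥ δ (!a) = 0 := fun a => Finset.sum_eq_zero fun x _ => by
      by_cases hx : g x = a
      · rw [hδ (!a) x (by rw [hx]; simp), mul_zero]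
      · rw [hδ a x hx, zero_mul]
    have hz' : ∀ a, δ a ⬝ᵥ (Γ *ᵥ δ a) = 0 := fun a => by
      simp only [dotProduct, Matrix.mulVec, Finset.mul_sum]
      refine Finset.sum_eq_zero fun x _ => Finset.sum_eq_zero fun y _ => ?_
      by_cases hx : g x = a
      · by_cases hy : g y = a
        · rw [hΓ.2 x y (hx.trans hy.symm), zero_mul, mul_zero]
        · rw [hδ a y hy, mul_zero, mul_zero]
      · rw [hδ a x hx, zero_mul]
    obtain rfl | hbb := eq_or_ne b' b
    · rw [hδ1, hz', mul_zero, add_zero]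
    · have : b' = !b := by
        revert hbb
        cases b <;> cases b' <;> simp
      rw [this, hz, hδΓ, inv_mul_cancel₀ h0.ne', zero_add]
  have hψM : ∀ z w, ∑ x, ∑ y, ψ z x * ψ w y * M x y = 1 := by
    intro z w
    simp only [ψ, M, ← Finset.prod_mul_distrib]
    have h1 : ∀ x : Fin N → Cube m, ∑ y : Fin N → Cube m,
        ∏ p, δ (z p) (x p) * δ (w p) (y p) * (Rᵀ * R) (x p) (y p) =
          ∏ p, ∑ y, δ (z p) (x p) * δ (w p) y * (Rᵀ * R) (x p) y := by
      intro x
      rw [Finset.prod_univ_sum, Fintype.piFinset_univ]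
    simp only [h1]
    have := Finset.prod_univ_sum (fun _ : Fin N => (Finset.univ : Finset (Cube m)))
      fun p x => ∑ y, δ (z p) x * δ (w p) y * (Rᵀ * R) x y
    rw [Fintype.piFinset_univ] at this
    rw [← this]
    exact Finset.prod_eq_one fun p _ => hδM (z p) (w p)
  let ε := (blockEquiv N m).symm
  let U : (Fin N → Cube m) → Fin N → Fin m → Fin d → ℝ :=
    fun x p q => u (ε x) (finProdFinEquiv (p, q))
  let V : (Fin N → Cube m) → Fin N → Fin m → Fin d → ℝ :=
    fun x p q => v (ε x) (finProdFinEquiv (p, q))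
  have hUV : ∀ x y, ∑ p, ∑ q, (if x p q ≠ y p q then U x p q ⬝ᵥ V y p q else 0) =
      1 - ∑ a, σ (ε x) a ⬝ᵥ σ (ε y) a := by
    intro x y
    rw [← h, Finset.sum_filter, sum_fin_mul]
    simp only [ε, blockEquiv_symm_apply, U, V]
  -- When `z p ≠ w p`, factor `p` of `M` restricted to differing bits `q` is `‖Γ‖⁻¹ • (Γ ⊙
  -- diffMatrix q)`, written as `1ᵀ * (Γ ⊙ diffMatrix q)`. The other factors stay `Rᵀ * R`, so `S p`
  -- goes to `u` and `T p q` to `v`.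
  let S : Fin N → Fin N → Matrix (Cube m) (Cube m) ℝ := fun p => Function.update (fun _ => R) p 1
  let T : Fin N → Fin m → Fin N → Matrix (Cube m) (Cube m) ℝ := fun p q =>
    Function.update (fun _ => R) p (Γ ⊙ diffMatrix q)
  -- The factor `‖Γ‖⁻¹` is shared equally, so both costs are divided by `‖Γ‖`.
  let s := (√‖Γ‖)⁻¹
  have hs : s * s = ‖Γ‖⁻¹ := by rw [← mul_inv, Real.mul_self_sqrt h0.le]
  let u' : Cube N → Fin N → Fin m × Fin d × (Fin N → Cube m) → ℝ := fun z p k =>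
    s * (piKronecker (S p) *ᵥ fun x => ψ z x * U x p k.1 k.2.1) k.2.2
  let v' : Cube N → Fin N → Fin m × Fin d × (Fin N → Cube m) → ℝ := fun z p k =>
    s * (piKronecker (T p k.1) *ᵥ fun x => ψ z x * V x p k.1 k.2.1) k.2.2
  let σ' : Cube N → Fin K → Fin e × (Fin N → Cube m) → ℝ := fun z a k =>
    (piKronecker (fun _ => R) *ᵥ fun x => ψ z x * σ (ε x) a k.1) k.2
  have hdot : ∀ a b : Fin m → Fin d → (Fin N → Cube m) → ℝ,
      (fun k : Fin m × Fin d × (Fin N → Cube m) => s * a k.1 k.2.1 k.2.2) ⬝ᵥ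
        (fun k => s * b k.1 k.2.1 k.2.2) = ‖Γ‖⁻¹ * ∑ q, ∑ j, a q j ⬝ᵥ b q j := by
    intro a b
    simp only [dotProduct, Fintype.sum_prod_type, Finset.mul_sum, ← hs]
    exact Finset.sum_congr rfl fun _ _ => Finset.sum_congr rfl fun _ _ =>
      Finset.sum_congr rfl fun _ _ => by ring
  -- The norm bound, for either of the two families of vectors.
  have hnorm : ∀ (W : (Fin N → Cube m) → Fin N → Fin m → Fin d → ℝ)
      (Q : Fin N → Fin m → Fin N → Matrix (Cube m) (Cube m) ℝ),
      (∀ p q p', p' ≠ p → Q p q p' = R) → (∀ p q, (1 - (Q p q p)ᵀ * Q p q p).PosSemidef) →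
      (∀ x, ∑ p, ∑ q, W x p q ⬝ᵥ W x p q ≤ c) → ∀ z,
      ∑ p, ‖Γ‖⁻¹ * ∑ q, ∑ j, (piKronecker (Q p q) *ᵥ fun x => ψ z x * W x p q j) ⬝ᵥ
        (piKronecker (Q p q) *ᵥ fun x => ψ z x * W x p q j) ≤ c / ‖Γ‖ := by
    intro W Q hQ hQp hW z
    rw [← Finset.mul_sum, div_eq_inv_mul]
    refine mul_le_mul_of_nonneg_left ?_ (inv_nonneg.mpr h0.le)
    have h1 : ∀ p q j, (piKronecker (Q p q) *ᵥ fun x => ψ z x * W x p q j) ⬝ᵥ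
        (piKronecker (Q p q) *ᵥ fun x => ψ z x * W x p q j) ≤
          ∑ x, ψ z x * ψ z x * (W x p q j * W x p q j) := by
      intro p q j
      refine (piKronecker_mulVec_dotProduct_self_le g (Q p q) p
        (fun p' hp' x y hxy => by rw [hQ p q p' hp', hM₁ x y hxy]) (hQp p q) z _
        fun x hx => hψ z x (left_ne_zero_of_mul hx)).trans (le_of_eq ?_)
      exact Finset.sum_congr rfl fun x _ => by ring
    calc _ ≤ ∑ p, ∑ q, ∑ j, ∑ x, ψ z x * ψ z x * (W x p q j * W x p q j) :=
          Finset.sum_le_sum fun p _ => Finset.sum_le_sum fun q _ =>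
            Finset.sum_le_sum fun j _ => h1 p q j
      _ = ∑ x, ψ z x * ψ z x * ∑ p, ∑ q, W x p q ⬝ᵥ W x p q := by
          symm
          simp only [dotProduct, Finset.mul_sum]
          rw [Finset.sum_comm]
          refine Finset.sum_congr rfl fun p _ => ?_
          rw [Finset.sum_comm]
          refine Finset.sum_congr rfl fun q _ => ?_
          rw [Finset.sum_comm]
      _ ≤ ∑ x, ψ z x * ψ z x * c :=
          Finset.sum_le_sum fun x _ => mul_le_mul_of_nonneg_left (hW x) (mul_self_nonneg _)
      _ = c := by rw [← Finset.sum_mul, hψψ, one_mul]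
  refine advRel_le_of_dotProduct u' v' σ' (c / ‖Γ‖) (fun z w => ?_) (fun z a hza => ?_)
    (fun z => ?_) (fun z => ?_)
  · have hp : ∀ p, (if z p ≠ w p then u' z p ⬝ᵥ v' w p else 0) =
        ∑ x, ∑ y, ψ z x * ψ w y * M x y *
          ∑ q, (if x p q ≠ y p q then U x p q ⬝ᵥ V y p q else 0) := by
      intro p
      split_ifs with hzw
      · refine (hdot (fun q j => piKronecker (S p) *ᵥ fun x => ψ z x * U x p q j)
          (fun q j => piKronecker (T p q) *ᵥ fun x => ψ w x * V x p q j)).trans ?_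
        have h1 := fun q => sum_mulVec_dotProduct_mulVec (piKronecker (S p)) (piKronecker (T p q))
          (ψ z) (ψ w) (fun x => U x p q) (fun x => V x p q)
        simp only [piKronecker_transpose_mul] at h1
        simp only [h1, Finset.mul_sum]
        rw [Finset.sum_comm]
        refine Finset.sum_congr rfl fun x _ => ?_
        rw [Finset.sum_comm]
        refine Finset.sum_congr rfl fun y _ => Finset.sum_congr rfl fun q _ => ?_
        by_cases hx : ψ z x = 0
        · simp only [hx, zero_mul, mul_zero]
        by_cases hy : ψ w y = 0
        · simp only [hy, zero_mul, mul_zero]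
        have hg : g (x p) ≠ g (y p) := by rwa [hψ z x hx p, hψ w y hy p]
        have key : ‖Γ‖⁻¹ * piKronecker (fun p' => (S p p')ᵀ * T p q p') x y =
            M x y * (if x p q ≠ y p q then 1 else 0) := by
          simp only [M, piKronecker_apply]
          rw [← Finset.mul_prod_erase _ _ (Finset.mem_univ p),
            ← Finset.mul_prod_erase _ (fun p' => (Rᵀ * R) (x p') (y p')) (Finset.mem_univ p),
            hM₁' _ _ hg]
          have hrest : ∀ p' ∈ Finset.univ.erase p, ((S p p')ᵀ * T p q p') (x p') (y p') =
              (Rᵀ * R) (x p') (y p') := fun p' hp' => by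
            simp only [S, T, Function.update_of_ne (Finset.ne_of_mem_erase hp')]
          rw [Finset.prod_congr rfl hrest]
          have hpp : ((S p p)ᵀ * T p q p) (x p) (y p) =
              Γ (x p) (y p) * (if x p q ≠ y p q then 1 else 0) := by
            simp only [S, T, Function.update_self, Matrix.transpose_one, one_mul]
            rfl
          rw [hpp]
          ring
        calc _ = ψ z x * ψ w y * (‖Γ‖⁻¹ * piKronecker (fun p' => (S p p')ᵀ * T p q p') x y) *
              (U x p q ⬝ᵥ V y p q) := by ring
          _ = _ := by
            rw [key]
            split_ifs <;> ring
      -- If `z p = w p`, then on the supports `M` forces `x p = y p`, and block `p` has no differing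
      -- bits.
      · refine (Finset.sum_eq_zero fun x _ => Finset.sum_eq_zero fun y _ => ?_).symm
        by_cases hx : ψ z x = 0
        · simp only [hx, zero_mul]
        by_cases hy : ψ w y = 0
        · simp only [hy, zero_mul, mul_zero]
        have hg : g (x p) = g (y p) := by
          rw [hψ z x hx p, hψ w y hy p]
          exact not_not.mp hzw
        by_cases hxy : x p = y p
        · simp [hxy]
        · have : M x y = 0 := Finset.prod_eq_zero (Finset.mem_univ p)
            ((hM₁ _ _ hg).trans (Matrix.one_apply_ne hxy))
          rw [this, mul_zero, zero_mul]
    have hσσ : ∀ a, σ' z a ⬝ᵥ σ' w a =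
        ∑ x, ∑ y, ψ z x * ψ w y * M x y * (σ (ε x) a ⬝ᵥ σ (ε y) a) := by
      intro a
      have h1 := sum_mulVec_dotProduct_mulVec (piKronecker fun _ : Fin N => R)
        (piKronecker fun _ : Fin N => R) (ψ z) (ψ w) (fun x => σ (ε x) a) (fun x => σ (ε x) a)
      simp only [piKronecker_transpose_mul, piKronecker_apply] at h1
      rw [← h1]
      simp only [σ', dotProduct, Fintype.sum_prod_type]
    rw [Finset.sum_filter]
    simp only [hp, hσσ]
    -- The constant `1` is replaced by the total weight from `hψM`, after which the identity holds
    -- term by term in `(x, y)`.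
    rw [Finset.sum_comm, Finset.sum_comm (s := (Finset.univ : Finset (Fin K))), ← hψM z w,
      ← Finset.sum_sub_distrib]
    refine Finset.sum_congr rfl fun x _ => ?_
    rw [Finset.sum_comm, Finset.sum_comm (s := (Finset.univ : Finset (Fin K))),
      ← Finset.sum_sub_distrib]
    refine Finset.sum_congr rfl fun y _ => ?_
    rw [← Finset.mul_sum, hUV, ← Finset.mul_sum, mul_sub, mul_one]
  · have : (fun (k : Fin e) (x : Fin N → Cube m) => ψ z x * σ (ε x) a k) = 0 := by
      funext k x
      by_cases hx : ψ z x = 0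
      · simp [hx]
      have hmem : (ε x, a) ∉ relComp f g := by
        have hz : (fun p => g (x p)) = z := funext (hψ z x hx)
        simpa only [relComp, Set.mem_ofPred_eq, ε, blockMap_blockEquiv_symm, hz] using hza
      simp [hσ _ _ hmem]
    funext k
    have hk := congrFun this k.1
    simp only [σ', hk]
    simp
  · refine (Finset.sum_congr rfl fun p _ => hdot
      (fun q j => piKronecker (S p) *ᵥ fun x => ψ z x * U x p q j)
      (fun q j => piKronecker (S p) *ᵥ fun x => ψ z x * U x p q j)).trans_le ?_
    refine hnorm U (fun p _ => S p) (fun p q p' hp' => Function.update_of_ne hp' _ _)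
      (fun p q => ?_) (fun x => ?_) z
    · simp only [S, Function.update_self, Matrix.transpose_one, mul_one, sub_self]
      exact Matrix.PosSemidef.zero
    · simpa only [sum_fin_mul] using hu (ε x)
  · refine (Finset.sum_congr rfl fun p _ => hdot
      (fun q j => piKronecker (T p q) *ᵥ fun x => ψ z x * V x p q j)
      (fun q j => piKronecker (T p q) *ᵥ fun x => ψ z x * V x p q j)).trans_le ?_
    refine hnorm V T (fun p q p' hp' => Function.update_of_ne hp' _ _)
      (fun p q => ?_) (fun x => ?_) z
    · simp only [T, Function.update_self]
      exact Matrix.posSemidef_one_sub_transpose_mul_self (hD q)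
    · simpa only [sum_fin_mul] using hv (ε x)

/-! ### Duality for the functional adversary bound -/

theorem adv_nonneg {m : ℕ} (g : Cube m → Bool) : 0 ≤ adv g :=
  Real.sSup_nonneg (by rintro c ⟨Γ, -, -, rfl⟩; exact norm_nonneg Γ)

theorem dotProduct_mulVec_eq_sum {X : Type*} [Fintype X] (A : Matrix X X ℝ) (v : X → ℝ) :
    v ⬝ᵥ (A *ᵥ v) = ∑ x, ∑ y, A x y * (v x * v y) := by
  simp only [dotProduct, Matrix.mulVec, Finset.mul_sum]
  exact Finset.sum_congr rfl fun x _ => Finset.sum_congr rfl fun y _ => by ring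

/-- Adding a multiple of the identity makes a real symmetric matrix with small entries positive
semidefinite. -/
theorem Matrix.IsSymm.posSemidef_add_smul_one {X : Type*} [Fintype X] [DecidableEq X]
    {A : Matrix X X ℝ} (hA : A.IsSymm) {η : ℝ} (h : ∀ x y, |A x y| ≤ η) :
    (A + (η * Fintype.card X) • (1 : Matrix X X ℝ)).PosSemidef := by
  rw [Matrix.posSemidef_real_iff]
  refine ⟨by simp [Matrix.IsSymm, hA.eq], fun v => ?_⟩
  rw [Matrix.add_mulVec, Matrix.smul_mulVec, Matrix.one_mulVec, dotProduct_add, dotProduct_smul,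
    smul_eq_mul, dotProduct_mulVec_eq_sum]
  have h1 : ∀ x y, -(η * ((v x * v x + v y * v y) / 2)) ≤ A x y * (v x * v y) := by
    intro x y
    refine (abs_le.mp ?_).1
    rw [abs_mul]
    refine mul_le_mul (h x y) ?_ (abs_nonneg _) ((abs_nonneg _).trans (h x y))
    rw [abs_le]
    constructor <;> nlinarith [sq_nonneg (v x + v y), sq_nonneg (v x - v y)]
  have h2 := Finset.sum_le_sum fun x (_ : x ∈ Finset.univ) =>
    Finset.sum_le_sum fun y (_ : y ∈ Finset.univ) => h1 x y
  have h3 : ∑ x, ∑ y, -(η * ((v x * v x + v y * v y) / 2)) =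
      -(η * Fintype.card X * (v ⬝ᵥ v)) := by
    simp only [Finset.sum_neg_distrib, ← Finset.mul_sum, ← Finset.sum_div, Finset.sum_add_distrib,
      Finset.sum_const, Finset.card_univ, nsmul_eq_mul, dotProduct]
    simp only [mul_left_comm (v _) (Fintype.card X : ℝ), ← Finset.mul_sum]
    ring
  linarith

/-- Weak duality for `adv g`, in terms of an unnormalized weight matrix `Ψ`. -/
theorem sum_le_adv_mul_sum {m : ℕ} {g : Cube m → Bool} {Ψ : Matrix (Cube m) (Cube m) ℝ}
    (hΨ : IsAdversaryMatrix g Ψ) {μ : Cube m → ℝ} (hμ : ∀ x, 0 < μ x)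
    (h : ∀ i v, |v ⬝ᵥ ((Ψ ⊙ diffMatrix i) *ᵥ v)| ≤ ∑ x, μ x * (v x * v x)) :
    ∑ x, ∑ y, Ψ x y ≤ adv g * ∑ x, μ x := by
  let r : Cube m → ℝ := fun x => √(μ x)
  have hr : ∀ x, r x * r x = μ x := fun x => Real.mul_self_sqrt (hμ x).le
  have hr0 : ∀ x, r x ≠ 0 := fun x => (Real.sqrt_pos.mpr (hμ x)).ne'
  -- Conjugating `Ψ` by `diag(μ)^{-1/2}` turns the hypothesis into the norm constraints; the test
  -- vector `√μ` then recovers the sum of the entries of `Ψ`.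
  let Γ : Matrix (Cube m) (Cube m) ℝ := Matrix.of fun x y => Ψ x y * ((r x)⁻¹ * (r y)⁻¹)
  have hΓa : ∀ x y, Γ x y = Ψ x y * ((r x)⁻¹ * (r y)⁻¹) := fun _ _ => rfl
  have hΓ : IsAdversaryMatrix g Γ := by
    refine ⟨Matrix.IsSymm.ext fun x y => ?_, fun x y hxy => ?_⟩
    · rw [hΓa, hΓa, hΨ.1.apply, mul_comm (r x)⁻¹]
    · rw [hΓa, hΨ.2 x y hxy, zero_mul]
  have hD : ∀ i, ‖Γ ⊙ diffMatrix i‖ ≤ 1 := by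
    intro i
    refine Matrix.IsSymm.l2_opNorm_le_one (Matrix.IsSymm.ext fun x y => ?_) fun v => ?_
    · rw [Matrix.hadamard_apply, Matrix.hadamard_apply, hΓ.1.apply]
      simp only [diffMatrix, Matrix.of_apply, ne_comm]
    · have h1 := h i fun x => (r x)⁻¹ * v x
      rw [dotProduct_mulVec_eq_sum] at h1 ⊢
      convert h1 using 1
      · refine congrArg _ (Finset.sum_congr rfl fun x _ => Finset.sum_congr rfl fun y _ => ?_)
        rw [Matrix.hadamard_apply, Matrix.hadamard_apply, hΓa]
        ring
      · refine Finset.sum_congr rfl fun x _ => ?_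
        rw [← hr]
        have := hr0 x
        field_simp
  have hle : ‖Γ‖ ≤ adv g := le_csSup (advValues_bddAbove g) ⟨Γ, hΓ, hD, rfl⟩
  have h2 := (abs_le.mp (Γ.abs_dotProduct_mulVec_self_le r)).2
  have h3 : r ⬝ᵥ (Γ *ᵥ r) = ∑ x, ∑ y, Ψ x y := by
    rw [dotProduct_mulVec_eq_sum]
    refine Finset.sum_congr rfl fun x _ => Finset.sum_congr rfl fun y _ => ?_
    rw [hΓa]
    have := hr0 x
    have := hr0 y
    field_simp
  have h4 : r ⬝ᵥ r = ∑ x, μ x := Finset.sum_congr rfl fun x _ => hr x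
  rw [h3, h4] at h2
  exact h2.trans (mul_le_mul_of_nonneg_right hle (Finset.sum_nonneg fun x _ => (hμ x).le))

/-- The cone of pairs `(W, a)` such that `W` is, where `g` takes different values, a sum of the
positive semidefinite matrices `P i` restricted to the pairs that differ at `i`, and the sum of the
diagonals of the `P i` is at most `a`. -/
def dualCone {m : ℕ} (g : Cube m → Bool) : Set ((Cube m → Cube m → ℝ) × (Cube m → ℝ)) :=
  {k | ∃ P : Fin m → Matrix (Cube m) (Cube m) ℝ, (∀ i, (P i).PosSemidef) ∧
    (∀ x y, k.1 x y = if g x ≠ g y then ∑ i with x i ≠ y i, P i x y else 0) ∧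
    ∀ x, ∑ i, P i x x ≤ k.2 x}

theorem dualCone_add {m : ℕ} {g : Cube m → Bool} {k l} (hk : k ∈ dualCone g)
    (hl : l ∈ dualCone g) : k + l ∈ dualCone g := by
  obtain ⟨P, hP, hk1, hk2⟩ := hk
  obtain ⟨Q, hQ, hl1, hl2⟩ := hl
  refine ⟨fun i => P i + Q i, fun i => (hP i).add (hQ i), fun x y => ?_, fun x => ?_⟩
  · simp only [Prod.fst_add, Pi.add_apply, hk1, hl1, Matrix.add_apply, Finset.sum_add_distrib]
    split_ifs <;> simp
  · simp only [Prod.snd_add, Pi.add_apply, Matrix.add_apply, Finset.sum_add_distrib]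
    exact add_le_add (hk2 x) (hl2 x)

theorem dualCone_smul {m : ℕ} {g : Cube m → Bool} {k} (hk : k ∈ dualCone g) {t : ℝ}
    (ht : 0 ≤ t) : t • k ∈ dualCone g := by
  obtain ⟨P, hP, hk1, hk2⟩ := hk
  refine ⟨fun i => t • P i, fun i => (hP i).smul ht, fun x y => ?_, fun x => ?_⟩
  · simp only [Prod.smul_fst, Pi.smul_apply, hk1, Matrix.smul_apply, smul_eq_mul,
      ← Finset.mul_sum]
    split_ifs <;> simp
  · simp only [Prod.smul_snd, Pi.smul_apply, Matrix.smul_apply, smul_eq_mul, ← Finset.mul_sum]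
    exact mul_le_mul_of_nonneg_left (hk2 x) ht

theorem convex_dualCone {m : ℕ} (g : Cube m → Bool) : Convex ℝ (dualCone g) :=
  fun _ hk _ hl _ _ ha hb _ => dualCone_add (dualCone_smul hk ha) (dualCone_smul hl hb)

/-- The matrix with entry `1` where `g` takes different values, and `0` elsewhere. -/
def neIndicator {m : ℕ} (g : Cube m → Bool) : Cube m → Cube m → ℝ :=
  fun x y => if g x ≠ g y then 1 else 0

/-- Near-feasible points of the dual problem can be corrected at a small cost. -/
theorem mem_dualCone_of_mem_closure {m : ℕ} {g : Cube m → Bool} {A B : ℝ} (hAB : A < B)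
    (h : (neIndicator g, fun _ => A) ∈ closure (dualCone g)) :
    (neIndicator g, fun _ => B) ∈ dualCone g := by
  -- The bound on the diagonals grows by `η` from the approximation and by `η * card` from each of
  -- the `m` diagonal shifts below, in total `η * C = B - A`.
  let C : ℝ := 1 + m * Fintype.card (Cube m)
  have hC : 0 < C := by positivity
  let η := (B - A) / C
  have hη : 0 < η := div_pos (sub_pos.mpr hAB) hC
  obtain ⟨k, ⟨P, hP, hk1, hk2⟩, hd⟩ := Metric.mem_closure_iff.mp h η hη
  rw [Prod.dist_eq, max_lt_iff] at hd
  have hd1 : ∀ x y, |neIndicator g x y - k.1 x y| ≤ η := fun x y => by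
    rw [← Real.dist_eq]
    exact (dist_le_pi_dist _ _ y).trans ((dist_le_pi_dist _ _ x).trans hd.1.le)
  have hd2 : ∀ x, k.2 x ≤ A + η := fun x => by
    have h1 := (dist_le_pi_dist _ _ x).trans hd.2.le
    rw [Real.dist_eq, abs_le] at h1
    linarith [h1.1]
  let R : Cube m → Cube m → ℝ := fun x y => neIndicator g x y - k.1 x y
  have hPs : ∀ i x y, P i x y = P i y x := fun i x y =>
    ((Matrix.posSemidef_real_iff.mp (hP i)).1.apply x y).symm
  have hRs : ∀ x y, R x y = R y x := by
    intro x y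
    simp only [R, neIndicator, hk1, ne_comm (a := g x), hPs _ x y, ne_comm (a := x _)]
  let n : Cube m → Cube m → ℝ := fun x y => (Finset.univ.filter fun i => x i ≠ y i).card
  -- The residual `R x y` is spread evenly over the coordinates where `x` and `y` differ.
  let Q : Fin m → Matrix (Cube m) (Cube m) ℝ := fun i =>
    Matrix.of fun x y => if x i ≠ y i then (n x y)⁻¹ * R x y else 0
  have hQa : ∀ i x y, Q i x y = if x i ≠ y i then (n x y)⁻¹ * R x y else 0 := fun _ _ _ => rfl
  have hQs : ∀ i, (Q i).IsSymm := fun i => Matrix.IsSymm.ext fun x y => by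
    simp only [hQa, n, hRs x y, ne_comm (a := x _)]
  have hQη : ∀ i x y, |Q i x y| ≤ η := by
    intro i x y
    rw [hQa]
    split_ifs with hi
    · have hn : 1 ≤ n x y := by
        simp only [n, Nat.one_le_cast, Finset.one_le_card]
        exact ⟨i, by simpa using hi⟩
      rw [abs_mul, abs_inv, abs_of_pos (zero_lt_one.trans_le hn)]
      exact (mul_le_of_le_one_left (abs_nonneg _) (inv_le_one_of_one_le₀ hn)).trans (hd1 x y)
    · simpa using hη.le
  refine ⟨fun i => P i + (Q i + (η * Fintype.card (Cube m)) • 1), fun i =>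
    (hP i).add ((hQs i).posSemidef_add_smul_one (hQη i)), fun x y => ?_, fun x => ?_⟩
  · by_cases hg : g x = g y
    · simp [neIndicator, hg]
    have hne : x ≠ y := fun e => hg (congrArg g e)
    obtain ⟨i, hi⟩ := Function.ne_iff.mp hne
    have hn : n x y ≠ 0 := by
      simp only [n, ne_eq, Nat.cast_eq_zero]
      exact Finset.card_ne_zero_of_mem (Finset.mem_filter.mpr ⟨Finset.mem_univ i, hi⟩)
    have hk := hk1 x y
    rw [if_pos hg] at hk
    have hQsum : ∑ i with x i ≠ y i, Q i x y = R x y := by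
      rw [Finset.sum_congr rfl fun i hi => (hQa i x y).trans (if_pos (Finset.mem_filter.mp hi).2),
        Finset.sum_const, nsmul_eq_mul]
      exact mul_inv_cancel_left₀ hn _
    simp only [if_pos hg, Matrix.add_apply, Matrix.smul_apply, Matrix.one_apply_ne hne, smul_zero,
      add_zero, Finset.sum_add_distrib, hQsum, ← hk, R, add_sub_cancel]
  · have hQ0 : ∀ i, Q i x x = 0 := fun i => by simp [hQa]
    simp only [Matrix.add_apply, Matrix.smul_apply, Matrix.one_apply_eq, hQ0, zero_add,
      Finset.sum_add_distrib, Finset.sum_const, Finset.card_univ, Fintype.card_fin, nsmul_eq_mul,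
      smul_eq_mul, mul_one]
    have h1 := (hk2 x).trans (hd2 x)
    have h2 : η * C = B - A := div_mul_cancel₀ _ hC.ne'
    simp only [C] at h2
    linarith

/-- Strong duality for `adv g`, up to an arbitrarily small error. -/
theorem neIndicator_mem_closure_dualCone {m : ℕ} {g : Cube m → Bool} {A : ℝ} (hA : adv g ≤ A) :
    (neIndicator g, fun _ => A) ∈ closure (dualCone g) := by
  by_contra hp
  obtain ⟨ℓ, s, hs, hsp⟩ :=
    geometric_hahn_banach_closed_point (convex_dualCone g).closure isClosed_closure hp
  have hs' : ∀ k ∈ dualCone g, ℓ k < s := fun k hk => hs k (subset_closure hk)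
  have h0 : (0 : (Cube m → Cube m → ℝ) × (Cube m → ℝ)) ∈ dualCone g :=
    ⟨fun _ => 0, fun _ => Matrix.PosSemidef.zero, fun x y => by simp, fun x => by simp⟩
  have hs0 : 0 < s := by simpa using hs' 0 h0
  -- A functional bounded above on a cone is nonpositive there.
  have hℓ : ∀ k ∈ dualCone g, ℓ k ≤ 0 := by
    intro k hk
    by_contra! hpos
    have := hs' _ (dualCone_smul hk (div_pos hs0 hpos).le)
    rw [map_smul, smul_eq_mul, div_mul_cancel₀ _ hpos.ne'] at this
    exact lt_irrefl _ this
  let Φ : Cube m → Cube m → ℝ := fun x y => ℓ (Pi.single x (Pi.single y 1), 0)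
  let μ : Cube m → ℝ := fun x => -ℓ (0, Pi.single x 1)
  have hexp : ∀ W a, ℓ (W, a) = ∑ x, ∑ y, Φ x y * W x y - ∑ x, μ x * a x := by
    intro W a
    have hW : (W, (0 : Cube m → ℝ)) =
        ∑ x, ∑ y, W x y • ((Pi.single x (Pi.single y 1) : Cube m → Cube m → ℝ),
          (0 : Cube m → ℝ)) := by
      refine Prod.ext ?_ ?_
      · funext x y
        simp [Prod.fst_sum, Finset.sum_apply, Pi.single_apply, Finset.sum_ite_eq, apply_ite,
          ite_apply]
      · simp [Prod.snd_sum]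
    have ha : ((0 : Cube m → Cube m → ℝ), a) =
        ∑ x, a x • ((0 : Cube m → Cube m → ℝ), (Pi.single x 1 : Cube m → ℝ)) := by
      refine Prod.ext ?_ ?_
      · simp [Prod.fst_sum]
      · funext x
        simp [Prod.snd_sum, Finset.sum_apply, Pi.single_apply]
    have hsplit : (W, a) = (W, (0 : Cube m → ℝ)) + ((0 : Cube m → Cube m → ℝ), a) := by simp
    rw [hsplit, map_add, hW, ha]
    simp only [map_sum, map_smul, smul_eq_mul, Φ, μ, neg_mul, Finset.sum_neg_distrib, sub_neg_eq_add]
    simp only [mul_comm]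
  have hμ : ∀ x, 0 ≤ μ x := by
    intro x
    have : ((0 : Cube m → Cube m → ℝ), (Pi.single x 1 : Cube m → ℝ)) ∈ dualCone g := by
      refine ⟨fun _ => 0, fun _ => Matrix.PosSemidef.zero, fun x y => by simp, fun y => ?_⟩
      by_cases h : y = x
      · subst h
        simp
      · simp [Pi.single_eq_of_ne h]
    exact neg_nonneg.mpr (hℓ _ this)
  let Ψ : Matrix (Cube m) (Cube m) ℝ :=
    Matrix.of fun x y => if g x ≠ g y then (Φ x y + Φ y x) / 2 else 0
  have hΨa : ∀ x y, Ψ x y = if g x ≠ g y then (Φ x y + Φ y x) / 2 else 0 := fun _ _ => rfl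
  have hΨ : IsAdversaryMatrix g Ψ := by
    refine ⟨Matrix.IsSymm.ext fun x y => ?_, fun x y hxy => ?_⟩
    · simp only [hΨa, ne_comm (a := g x), add_comm]
    · simp [hΨa, hxy]
  -- Symmetrizing the functional does not change its values on symmetric matrices.
  have hsymm : ∀ W : Cube m → Cube m → ℝ, (∀ x y, W x y = W y x) →
      (∀ x y, g x = g y → W x y = 0) →
      ∑ x, ∑ y, Φ x y * W x y = ∑ x, ∑ y, Ψ x y * W x y := by
    intro W hW hW0
    have h1 : ∑ x, ∑ y, Φ x y * W x y = ∑ x, ∑ y, Φ y x * W x y := by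
      rw [Finset.sum_comm]
      exact Finset.sum_congr rfl fun x _ => Finset.sum_congr rfl fun y _ => by rw [hW]
    have h2 : ∑ x, ∑ y, Ψ x y * W x y =
        (∑ x, ∑ y, Φ x y * W x y + ∑ x, ∑ y, Φ y x * W x y) / 2 := by
      simp only [← Finset.sum_add_distrib, Finset.sum_div]
      refine Finset.sum_congr rfl fun x _ => Finset.sum_congr rfl fun y _ => ?_
      rw [hΨa]
      by_cases hg : g x = g y
      · simp [hW0 x y hg]
      · simp only [ne_eq, hg, not_false_eq_true, if_true]
        ring
    rw [h2, ← h1]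
    ring
  have hquad : ∀ i v, v ⬝ᵥ ((Ψ ⊙ diffMatrix i) *ᵥ v) ≤ ∑ x, μ x * (v x * v x) := by
    intro i v
    let W : Cube m → Cube m → ℝ := fun x y =>
      if g x ≠ g y then (if x i ≠ y i then v x * v y else 0) else 0
    -- The rank-one matrix `v vᵀ` in position `i` alone tests the functional on the quadratic form
    -- of `Ψ ⊙ diffMatrix i`.
    have hmem : (W, fun x => v x * v x) ∈ dualCone g := by
      refine ⟨fun j => if j = i then Matrix.vecMulVec v v else 0, fun j => ?_, fun x y => ?_,
        fun x => ?_⟩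
      · beta_reduce
        split_ifs
        · exact Matrix.posSemidef_vecMulVec_self_star v
        · exact Matrix.PosSemidef.zero
      · simp only [W]
        refine if_congr Iff.rfl ?_ rfl
        rw [Finset.sum_filter, Finset.sum_eq_single i]
        · simp [Matrix.vecMulVec_apply]
        · intro j _ hj
          simp [hj]
        · simp
      · rw [Finset.sum_eq_single i]
        · simp [Matrix.vecMulVec_apply]
        · intro j _ hj
          simp [hj]
        · simp
    have h1 := hℓ _ hmem
    rw [hexp, sub_nonpos] at h1
    refine le_trans (le_of_eq ?_) h1
    rw [hsymm W, dotProduct_mulVec_eq_sum]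
    · refine Finset.sum_congr rfl fun x _ => Finset.sum_congr rfl fun y _ => ?_
      simp only [W, hΨa, Matrix.hadamard_apply, diffMatrix, Matrix.of_apply]
      split_ifs <;> ring
    · intro x y
      simp only [W, ne_comm (a := g x), ne_comm (a := x i), mul_comm]
    · intro x y hxy
      simp [W, hxy]
  have habs : ∀ i v, |v ⬝ᵥ ((Ψ ⊙ diffMatrix i) *ᵥ v)| ≤ ∑ x, μ x * (v x * v x) := by
    intro i v
    refine abs_le'.mpr ⟨hquad i v, ?_⟩
    -- `Ψ` only links different values of `g`, so changing the sign of `v` on one fibre negates the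
    -- form and keeps the right-hand side. This two-sided bound is why a single family `w` suffices
    -- in the dual.
    have h1 := hquad i fun x => if g x then -v x else v x
    have h2 : ∑ x, μ x * ((if g x then -v x else v x) * if g x then -v x else v x) =
        ∑ x, μ x * (v x * v x) := by
      refine Finset.sum_congr rfl fun x _ => ?_
      split_ifs <;> ring
    rw [h2] at h1
    refine le_trans (le_of_eq ?_) h1
    rw [dotProduct_mulVec_eq_sum, dotProduct_mulVec_eq_sum, ← Finset.sum_neg_distrib]
    refine Finset.sum_congr rfl fun x _ => ?_
    rw [← Finset.sum_neg_distrib]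
    refine Finset.sum_congr rfl fun y _ => ?_
    rw [Matrix.hadamard_apply, hΨa]
    cases g x <;> cases g y <;> simp
  have hp0 := hs0.trans hsp
  rw [hexp, hsymm (neIndicator g) (fun x y => by simp only [neIndicator, ne_comm (a := g x)])
    (fun x y hxy => by simp [neIndicator, hxy]), ← Finset.sum_mul] at hp0
  have hΨ1 : ∑ x, ∑ y, Ψ x y * neIndicator g x y = ∑ x, ∑ y, Ψ x y := by
    refine Finset.sum_congr rfl fun x _ => Finset.sum_congr rfl fun y _ => ?_
    simp only [hΨa, neIndicator]
    split_ifs <;> simp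
  rw [hΨ1] at hp0
  have hA0 : 0 ≤ A := (adv_nonneg g).trans hA
  let D : ℝ := A * Fintype.card (Cube m) + 1
  have hD : 0 < D := by positivity
  -- Weak duality needs strictly positive weights, so `μ` is raised by `κ`. By the choice of `D`
  -- this costs `A * card * κ`, which is the separation gap minus `κ`, so a contradiction remains.
  let κ := (∑ x, ∑ y, Ψ x y - (∑ x, μ x) * A) / D
  have hκ : 0 < κ := div_pos hp0 hD
  have hκD : κ * D = ∑ x, ∑ y, Ψ x y - (∑ x, μ x) * A := div_mul_cancel₀ _ hD.ne'
  have hfin := sum_le_adv_mul_sum hΨ (μ := fun x => μ x + κ)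
    (fun x => add_pos_of_nonneg_of_pos (hμ x) hκ) fun i v => (habs i v).trans
      (Finset.sum_le_sum fun x _ => mul_le_mul_of_nonneg_right (by linarith) (mul_self_nonneg _))
  have hfin2 : adv g * ∑ x, (μ x + κ) ≤ A * ∑ x, (μ x + κ) :=
    mul_le_mul_of_nonneg_right hA (Finset.sum_nonneg fun x _ => add_nonneg (hμ x) hκ.le)
  rw [Finset.sum_add_distrib, Finset.sum_const, Finset.card_univ, nsmul_eq_mul] at hfin hfin2
  simp only [D] at hκD
  linarith

/-- The vectors are columns of Gram factors of the positive semidefinite matrices in a dual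
solution. -/
theorem exists_dual_vectors {m : ℕ} (g : Cube m → Bool) {B : ℝ} (hB : adv g < B) :
    ∃ w : Cube m → Fin m → Cube m → ℝ,
      (∀ x y, g x ≠ g y → ∑ i with x i ≠ y i, w x i ⬝ᵥ w y i = 1) ∧
      ∀ x, ∑ i, w x i ⬝ᵥ w x i ≤ B := by
  obtain ⟨P, hP, h1, h2⟩ := mem_dualCone_of_mem_closure hB
    (neIndicator_mem_closure_dualCone (le_refl (adv g)))
  choose Q hQ using fun i => (hP i).exists_transpose_mul_self
  have hPQ : ∀ i x y, (fun k => Q i k x) ⬝ᵥ (fun k => Q i k y) = P i x y := by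
    intro i x y
    rw [hQ i]
    rfl
  refine ⟨fun x i k => Q i k x, fun x y hxy => ?_, fun x => ?_⟩
  · have := h1 x y
    rw [if_pos hxy] at this
    simp only [hPQ, ← this, neIndicator, if_pos hxy]
  · simpa only [hPQ] using h2 x

end

/-! ### The composition theorem -/

theorem mainTheorem1 {N m K : ℕ} (f : Set (Cube N × Fin K)) (hf : IsTotalRel f)
    (g : Cube m → Bool) :
    advRel (relComp f g) = advRel f * adv g := by
  apply le_antisymm
  · have hub : ∀ B, adv g < B → advRel (relComp f g) ≤ advRel f * B := by
      intro B hB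
      have hB0 : 0 < B := (adv_nonneg g).trans_lt hB
      obtain ⟨w, hw, hwB⟩ := exists_dual_vectors g hB
      rw [← div_le_iff₀ hB0]
      refine le_csInf (advRelValues_nonempty f hf) fun c hc => ?_
      rw [div_le_iff₀ hB0]
      exact advRel_relComp_le_mul w hw hwB hB0.le hc
    -- Dual vectors were found only at costs strictly above `adv g`, so the bound is passed to the
    -- limit from the right.
    have hlim : Filter.Tendsto (fun B => advRel f * B) (nhdsWithin (adv g) (Set.Ioi (adv g)))
        (nhds (advRel f * adv g)) :=
      ((continuous_const.mul continuous_id).tendsto (adv g)).mono_left nhdsWithin_le_nhds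
    exact ge_of_tendsto hlim (Filter.eventually_of_mem self_mem_nhdsWithin hub)
  · have hlb : ∀ a ∈ advValues g, advRel f * a ≤ advRel (relComp f g) := by
      rintro a ⟨Γ, hΓ, hD, rfl⟩
      exact le_csInf (advRelValues_nonempty _ (hf.relComp g)) fun c hc =>
        advRel_mul_norm_le hΓ hD hc
    obtain h0 | h0 := (advRel_nonneg f).eq_or_lt
    · rw [← h0, zero_mul]
      exact advRel_nonneg _
    · rw [← le_div_iff₀' h0]
      refine csSup_le (advValues_nonempty g) fun a ha => ?_
      rw [le_div_iff₀' h0]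
      exact hlb a ha
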